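/- Let $X=\{x_1<\dots<x_n\}$ be a finite totally ordered set of variables, and let $M$ be a multicomplex on $X$, i.e. a finite set of monomials in $x_1,\dots,x_n$ closed under taking divisors; $M_d$ denotes the set of monomials of total degree $d$ in $M$, and $\mathbb{R}M_d$ the real vector space with basis $M_d$. The boundary operator $\partial_d:\mathbb{R}M_d\to\mathbb{R}M_{d-1}$ is defined by $$\partial_d(x_1^{a_1}\cdots x_n^{a_n})=\sum_{j:\ a_j\text{ odd}}(-1)^{a_1+\dots+a_{j-1}}\,x_1^{a_1}\cdots x_j^{a_j-1}\cdots x_n^{a_n},$$ $\partial_d^*$ is its transpose with respect to the bases of monomials, and $L'_k=\partial_{k+1}\partial_{k+1}^*$, an operator on $\mathbb{R}M_k$. Let $\boldsymbol{s}'_k$ be the multiset of eigenvalues of $L'_k$. Multisets of non-negative integers are identified with their weakly decreasing rearrangements (partitions), partitions differing only in the number of zero parts are identified, and ${}^T$ denotes conjugation of partitions. For a monomial $p$ with $p^2\in M$, let $M^{(p^2)}$ be the simplicial complex of square-free monomials $q$ with $p^2q\in M$. For a multicomplex $N$ let $\boldsymbol{d}_k(N)=(d_1,\dots,d_n)$,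 where $d_j$ is the number of monomials in $N_k$ divisible by $x_j$. The multicomplex $M$ is shifted if $x_jm\in M$, $i<j$ and $x_i\in M$ imply $x_im\in M$, for every monomial $m$. **Theorem.** Suppose that $M$ is shifted and let $k\ge 0$. Then all eigenvalues of $L'_k$ are non-negative integers, and $$\boldsymbol{s}'_k=\sum_{p^2\in M,\ 2\deg(p)\le k}\boldsymbol{d}^{\,T}_{k+1-2\deg(p)}\bigl(M^{(p^2)}\bigr),$$ where the sum is the sum (union with multiplicities) of multisets. Equivalently, $$(\boldsymbol{s}'_k)^T=\sum_{x^{\alpha}\in M_{k+1}}(\alpha_1\bmod 2,\dots,\alpha_n\bmod 2),$$ where $\alpha_i \bmod 2\in\{0,1\}$ and the sum is the coordinatewise sum of integer vectors. The vector on the right, restricted to the coordinates $i$ with $x_i\in M$, is weakly decreasing (its other coordinates are $0$). -/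

import Mathlib

/-- A monomial `x₁^{a₁} ⋯ xₙ^{aₙ}` in the ordered variables indexed by `Fin n`, written additively
as its exponent vector; divisibility is `≤` and the product is `+`. -/
abbrev Mon (n : ℕ) : Type := Fin n →₀ ℕ

/-- A (finite) multicomplex: a finite set of monomials closed under taking divisors. -/
structure Multicomplex (n : ℕ) where
  carrier : Finset (Mon n)
  down_closed : ∀ m t : Mon n, m ≤ t → t ∈ carrier → m ∈ carrier

/-- The boundary operator of Björner and Vrećica on `ℝ[X]`, the vector space with basis the
monomials: `∂ m = ∑_j (-1)^{a₁ + ⋯ + a_{j-1}} r_j · (m / x_j)`, where `r_j = 1` if the exponent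
`a_j` of `x_j` in `m` is odd and `r_j = 0` otherwise. -/
noncomputable def boundary (n : ℕ) : (Mon n →₀ ℝ) →ₗ[ℝ] (Mon n →₀ ℝ) :=
  Finsupp.linearCombination ℝ fun m : Mon n =>
    ∑ j : Fin n, if Odd (m j) then
      Finsupp.single (m - Finsupp.single j 1) ((-1 : ℝ) ^ (∑ i ∈ Finset.univ.filter (· < j), m i))
    else 0

namespace Multicomplex

variable {n : ℕ}

/-- `M_d`: the monomials in `M` of total degree `d`. -/
noncomputable def graded (M : Multicomplex n) (d : ℕ) : Finset (Mon n) :=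
  M.carrier.filter fun m => m.degree = d

/-- The matrix, in the monomial bases, of the boundary map `∂_{d+1} : ℝM_{d+1} → ℝM_d`. -/
noncomputable def boundaryMatrix (M : Multicomplex n) (d : ℕ) :
    Matrix (M.graded d) (M.graded (d + 1)) ℝ :=
  Matrix.of fun t m => boundary n (Finsupp.single (m : Mon n) 1) (t : Mon n)

/-- The boundary operator on `ℝ[X]` sends `ℝM_{d+1}` into `ℝM_d`, and its restriction is given
by `boundaryMatrix`. -/
theorem boundary_single_eq_sum (M : Multicomplex n) (d : ℕ) (m : M.graded (d + 1)) :
    boundary n (Finsupp.single (m : Mon n) 1) =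
      ∑ t : M.graded d, Finsupp.single (t : Mon n) (M.boundaryMatrix d t m) := by
  classical
  have hsupp : ∀ t : Mon n, t ∉ M.graded d →
      boundary n (Finsupp.single (m : Mon n) 1) t = 0 := by
    intro t ht
    simp only [boundary, Finsupp.linearCombination_single, one_smul, Finsupp.finsetSum_apply]
    refine Finset.sum_eq_zero fun j _ => ?_
    split_ifs with hj
    · rw [Finsupp.single_apply, if_neg]
      rintro rfl
      apply ht
      obtain ⟨hm, hd⟩ := Finset.mem_filter.1 m.2
      refine Finset.mem_filter.2 ⟨M.down_closed _ _ tsub_le_self hm, ?_⟩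
      have hle : Finsupp.single j 1 ≤ (m : Mon n) := by
        rw [Finsupp.single_le_iff]
        exact hj.pos
      have h2 := congrArg Finsupp.degree (tsub_add_cancel_of_le hle)
      rw [map_add, Finsupp.degree_single, hd] at h2
      omega
    · rfl
  ext t
  rw [Finsupp.finsetSum_apply]
  by_cases ht : t ∈ M.graded d
  · rw [Finset.sum_eq_single ⟨t, ht⟩]
    · simp [boundaryMatrix]
    · intro b _ hb
      rw [Finsupp.single_apply, if_neg]
      intro h
      exact hb (Subtype.ext h)
    · simp
  · rw [hsupp t ht, eq_comm]
    refine Finset.sum_eq_zero fun b _ => ?_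
    rw [Finsupp.single_apply, if_neg]
    rintro rfl
    exact ht b.2

/-- The boundary map `∂_{d+1} : ℝM_{d+1} → ℝM_d`. -/
noncomputable def boundaryMap (M : Multicomplex n) (d : ℕ) :
    (M.graded (d + 1) → ℝ) →ₗ[ℝ] (M.graded d → ℝ) :=
  Matrix.toLin' (M.boundaryMatrix d)

/-- The dual map `∂_{d+1}^* : ℝM_d → ℝM_{d+1}`, whose matrix in the monomial bases is the
transpose of that of `∂_{d+1}`. -/
noncomputable def coboundaryMap (M : Multicomplex n) (d : ℕ) :
    (M.graded d → ℝ) →ₗ[ℝ] (M.graded (d + 1) → ℝ) :=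
  Matrix.toLin' (M.boundaryMatrix d).transpose

/-- The operator `L'_d = ∂_{d+1} ∂_{d+1}^*` on `ℝM_d`. -/
noncomputable def upLaplacian (M : Multicomplex n) (d : ℕ) :
    (M.graded d → ℝ) →ₗ[ℝ] (M.graded d → ℝ) :=
  M.boundaryMap d ∘ₗ M.coboundaryMap d

/-- The spectrum `s'_d`: the multiset of the eigenvalues of `L'_d`, with multiplicity. -/
noncomputable def upSpectrum (M : Multicomplex n) (d : ℕ) : Multiset ℝ :=
  (M.upLaplacian d).charpoly.roots

/-- The support of `M`: the indices of the variables that belong to `M`. -/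
def vertices (M : Multicomplex n) : Set (Fin n) :=
  {i | Finsupp.single i 1 ∈ M.carrier}

/-- `M` is shifted (relative to its support): if `x_j m ∈ M`, `i < j` and `x_i ∈ M`,
then `x_i m ∈ M`. -/
def IsShifted (M : Multicomplex n) : Prop :=
  ∀ (m : Mon n) (i j : Fin n), Finsupp.single j 1 + m ∈ M.carrier → i < j →
    i ∈ M.vertices → Finsupp.single i 1 + m ∈ M.carrier

/-- The monomials `p` with `p² ∈ M`. -/
noncomputable def squareRoots (M : Multicomplex n) : Finset (Mon n) :=
  M.carrier.filter fun p => 2 • p ∈ M.carrier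

theorem mem_squareRoots (M : Multicomplex n) (p : Mon n) :
    p ∈ M.squareRoots ↔ 2 • p ∈ M.carrier := by
  refine ⟨fun h => (Finset.mem_filter.1 h).2, fun h => Finset.mem_filter.2 ⟨?_, h⟩⟩
  refine M.down_closed _ _ (fun i => ?_) h
  simp only [Finsupp.smul_apply, smul_eq_mul]
  omega

/-- The simplicial complex `M^{(p²)}`: the square-free monomials `q` in `M` with `p² q ∈ M`,
regarded as a multicomplex. -/
noncomputable def piece (M : Multicomplex n) (p : Mon n) : Multicomplex n where
  carrier := M.carrier.filter fun q => 2 • p + q ∈ M.carrier ∧ ∀ i, q i ≤ 1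
  down_closed := by
    intro m t hmt ht
    obtain ⟨h1, h2, h3⟩ := Finset.mem_filter.1 ht
    exact Finset.mem_filter.2 ⟨M.down_closed _ _ hmt h1,
      M.down_closed _ _ (add_le_add_right hmt _) h2, fun i => (hmt i).trans (h3 i)⟩

/-- The degree sequence `d_k(M) = (d_1, …, d_n)`: `d_j` is the number of monomials in `M_k`
that are divisible by `x_j`. -/
noncomputable def degreeSequence (M : Multicomplex n) (k : ℕ) (j : Fin n) : ℕ :=
  ((M.graded k).filter fun m => Finsupp.single j 1 ≤ m).card

/-- The sum over the monomials `x^α ∈ M_k` of the parity vectors `α mod 2`. -/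
noncomputable def paritySum (M : Multicomplex n) (k : ℕ) : Fin n → ℕ :=
  ∑ α ∈ M.graded k, fun j => α j % 2

end Multicomplex

/-- The Young diagram of the partition that is the weakly decreasing rearrangement of a multiset
of natural numbers. Zero parts leave no trace in the diagram, so two multisets have the same
diagram exactly if they agree up to the multiplicity of zero. -/
def diagramOfParts (s : Multiset ℕ) : YoungDiagram :=
  YoungDiagram.ofRowLens (s.sort (· ≥ ·)) (Multiset.pairwise_sort s (· ≥ ·)).sortedGE

/-- The Young diagram of the partition obtained by rearranging a vector of natural numbers. -/
def diagramOfVector {n : ℕ} (v : Fin n → ℕ) : YoungDiagram :=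
  diagramOfParts (Finset.univ.val.map v)

/-- The multiset of (nonzero) parts of the conjugate of the partition given by a vector. -/
def conjugateParts {n : ℕ} (v : Fin n → ℕ) : Multiset ℕ :=
  ((diagramOfVector v).transpose.rowLens : Multiset ℕ)

/-! Up to zeros, `L'_k` has the spectrum of the Gram matrix `∂ᵀ∂` of the boundaries of the monomials
in `M_{k+1}`. This is computed in `exists_spectrum` by induction on the variables, for arbitrary
shifted families of monomials. Split the family by the parity of the exponent of the smallest
variable `x_i`. The Gram matrix becomes `[1 + W, B; Bᵀ, D]`, with `W` and `D` the Gram matrices of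
the two halves in the remaining variables. Shiftedness gives `D = Bᵀ B` (`coneBlock_transpose_mul`),
and the sign rule behind `∂∂ = 0` gives `W B = 0` (`boundaryGram_mul_coneBlock`). A Schur complement
then shows that the nonzero eigenvalues are those of `W` and `D` raised by one, padded with ones up
to the number of odd monomials. On Young diagrams this prepends a column, so the conjugate of the
spectrum is the vector of odd-exponent counts, i.e. the parity sum. Writing each monomial as `p² q`
with `q` square-free splits this vector over the pieces (`paritySum_eq_sum_piece`), and adding
vectors decreasing along one list conjugates to the union of multisets. -/

/-! ### Partitions, Young diagrams and conjugation -/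

theorem List.SortedGE.lt_countP_iff {L : List ℕ} (hL : L.SortedGE) (c j : ℕ) :
    c < L.countP (j < ·) ↔ j < L.getD c 0 := by
  induction L generalizing c with
  | nil => simp
  | cons a L ih =>
    have hp := List.pairwise_cons.1 hL.pairwise
    have ih := ih hp.2.sortedGE
    by_cases ha : j < a
    · cases c with
      | zero => simp [ha]
      | succ c => simpa [List.countP_cons, ha] using ih c
    · have h0 : L.countP (j < ·) = 0 := by
        rw [List.countP_eq_zero]
        intro b hb
        have := hp.1 b hb
        simp only [decide_eq_true_eq]
        omega
      cases c with
      | zero => simp [ha, h0]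
      | succ c =>
        have := ih c
        simp only [h0] at this
        simpa [List.countP_cons, ha, h0] using this

theorem YoungDiagram.mem_ofRowLens_iff_getD {w : List ℕ} {hw : w.SortedGE} (i j : ℕ) :
    (i, j) ∈ YoungDiagram.ofRowLens w hw ↔ j < w.getD i 0 := by
  rw [YoungDiagram.mem_ofRowLens]
  by_cases h : i < w.length
  · simp [h]
  · simp [h]

/-- Column `j` has as many cells as there are parts exceeding `j`. All later comparisons of
partitions use these counts, which ignore zeros. -/
theorem mem_diagramOfParts (s : Multiset ℕ) (i j : ℕ) :
    (i, j) ∈ diagramOfParts s ↔ i < s.countP (j < ·) := by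
  rw [diagramOfParts, YoungDiagram.mem_ofRowLens_iff_getD, ← List.SortedGE.lt_countP_iff
    (Multiset.pairwise_sort s (· ≥ ·)).sortedGE, ← Multiset.coe_countP, Multiset.sort_eq]

theorem diagramOfParts_eq_iff (s t : Multiset ℕ) :
    diagramOfParts s = diagramOfParts t ↔ ∀ j, s.countP (j < ·) = t.countP (j < ·) := by
  constructor
  · intro h j
    refine eq_of_forall_lt_iff fun i => ?_
    rw [← mem_diagramOfParts, ← mem_diagramOfParts, h]
  · intro h
    ext ⟨i, j⟩
    rw [YoungDiagram.mem_cells, YoungDiagram.mem_cells, mem_diagramOfParts, mem_diagramOfParts, h]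

theorem diagramOfParts_rowLens (μ : YoungDiagram) :
    diagramOfParts (μ.rowLens : Multiset ℕ) = μ := by
  ext ⟨i, j⟩
  rw [YoungDiagram.mem_cells, YoungDiagram.mem_cells, mem_diagramOfParts, Multiset.coe_countP,
    List.SortedGE.lt_countP_iff μ.rowLens_sorted,
    ← YoungDiagram.mem_ofRowLens_iff_getD (hw := μ.rowLens_sorted),
    YoungDiagram.ofRowLens_to_rowLens_eq_self]

/-- If `v` vanishes off `l` and decreases along `l`, then `v` is the conjugate of a multiset whose
number of parts exceeding `c` is the value of `v` at the `c`-th entry of `l`. -/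
theorem mem_diagramOfVector_iff {n : ℕ} {v : Fin n → ℕ} {l : List (Fin n)} (hl : l.Nodup)
    (h0 : ∀ i, i ∉ l → v i = 0) (hv : (l.map v).SortedGE) (i j : ℕ) :
    (i, j) ∈ diagramOfVector v ↔ j < (l.map v).getD i 0 := by
  rw [diagramOfVector, mem_diagramOfParts, ← hv.lt_countP_iff]
  congr! 1
  rw [Multiset.countP_map, List.countP_map, ← Finset.filter_val, Finset.card_val,
    List.countP_eq_length_filter,
    ← List.toFinset_card_of_nodup (hl.filter _)]
  congr 1
  ext a
  simp only [Finset.mem_filter, Finset.mem_univ, true_and, List.toFinset_filter, List.mem_toFinset,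
    Function.comp_apply, decide_eq_true_eq]
  refine ⟨fun h => ⟨by_contra fun ha => ?_, h⟩, fun h => h.2⟩
  rw [h0 a ha] at h
  omega

theorem countP_conjugateParts {n : ℕ} {v : Fin n → ℕ} {l : List (Fin n)} (hl : l.Nodup)
    (h0 : ∀ i, i ∉ l → v i = 0) (hv : (l.map v).SortedGE) (c : ℕ) :
    (conjugateParts v).countP (c < ·) = (l.map v).getD c 0 := by
  refine eq_of_forall_lt_iff fun j => ?_
  rw [← mem_diagramOfParts, conjugateParts, diagramOfParts_rowLens, YoungDiagram.mem_transpose,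
    Prod.swap_prod_mk, mem_diagramOfVector_iff hl h0 hv]

theorem transpose_diagramOfParts_eq {n : ℕ} {v : Fin n → ℕ} {l : List (Fin n)} (hl : l.Nodup)
    (h0 : ∀ i, i ∉ l → v i = 0) (hv : (l.map v).SortedGE) {s : Multiset ℕ}
    (hs : ∀ c, s.countP (c < ·) = (l.map v).getD c 0) :
    (diagramOfParts s).transpose = diagramOfVector v := by
  ext ⟨i, j⟩
  rw [YoungDiagram.mem_cells, YoungDiagram.mem_cells, YoungDiagram.mem_transpose,
    Prod.swap_prod_mk, mem_diagramOfParts, mem_diagramOfVector_iff hl h0 hv, hs]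

/-! ### Determinants `det (1 - x G)` and eigenvalues -/

namespace Matrix

variable {ι κ : Type*} [Fintype ι] [DecidableEq ι] [Fintype κ] [DecidableEq κ]

theorem det_one_sub_smul_mul_comm (A : Matrix ι κ ℝ) (B : Matrix κ ι ℝ) (x : ℝ) :
    (1 - x • (A * B)).det = (1 - x • (B * A)).det := by
  rw [← Matrix.smul_mul, Matrix.det_one_sub_mul_comm, Matrix.mul_smul]

/-- The determinant of `1 - x G` for the Gram matrix `G` of a cone-like boundary matrix. -/
theorem det_one_sub_smul_fromBlocks {W : Matrix ι ι ℝ} (hW : W.IsSymm) {B : Matrix ι κ ℝ}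
    (hWB : W * B = 0) {x : ℝ} (hx : x ≠ 1) :
    (1 - x • fromBlocks (1 + W) B B.transpose (B.transpose * B)).det =
      (1 - x) ^ Fintype.card ι * (1 - (x / (1 - x)) • W).det *
        (1 - (x / (1 - x)) • (B.transpose * B)).det := by
  have hx' : 1 - x ≠ 0 := sub_ne_zero.2 hx.symm
  have hBW : B.transpose * W = 0 := by
    rw [← hW.eq, ← transpose_mul, hWB, transpose_zero]
  -- This row operation turns the lower right block into `1`. The Schur complement `(1 - x) - x W -
  -- x B Bᵀ` then factors because `W B = 0`.
  have h1 : fromBlocks 1 0 (-B.transpose) 1 *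
      (1 - x • fromBlocks (1 + W) B B.transpose (B.transpose * B)) =
      fromBlocks (1 - x • (1 + W)) (-(x • B)) (-B.transpose) 1 := by
    rw [← fromBlocks_one, fromBlocks_smul, sub_eq_add_neg, fromBlocks_neg, fromBlocks_add,
      fromBlocks_multiply]
    congr 1
    · simp [sub_eq_add_neg]
    · simp
    · simp [Matrix.mul_add, hBW]
    · simp
  have h2 := congrArg det h1
  rw [det_mul, det_fromBlocks_zero₁₂, det_one, det_one, one_mul, one_mul,
    det_fromBlocks_one₂₂] at h2
  rw [h2, det_one_sub_smul_mul_comm B.transpose B, mul_assoc, ← det_mul, ← det_smul]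
  congr 1
  set y := x / (1 - x) with hy
  have hxy : (1 - x) * y = x := by rw [hy]; field_simp
  have e1 : W * (B * B.transpose) = 0 := by rw [← Matrix.mul_assoc, hWB, Matrix.zero_mul]
  have : (1 - y • W) * (1 - y • (B * B.transpose)) = 1 - y • W - y • (B * B.transpose) := by
    simp [Matrix.sub_mul, Matrix.mul_sub, e1]
  rw [this, smul_sub, smul_sub, smul_smul, smul_smul, hxy]
  rw [Matrix.neg_mul, Matrix.mul_neg, neg_neg, Matrix.smul_mul, smul_add, sub_smul, one_smul]
  abel

theorem continuous_det_one_sub_smul (G : Matrix ι ι ℝ) :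
    Continuous fun x : ℝ => (1 - x • G).det :=
  Continuous.matrix_det (by fun_prop)

/-- The polynomial `det (1 - x G)` is the reversed characteristic polynomial, so it determines all
roots except zeros. -/
theorem charpoly_roots_of_det_one_sub_smul {G : Matrix ι ι ℝ} {s : Multiset ℝ} (h0 : 0 ∉ s)
    (h : ∀ x : ℝ, (1 - x • G).det = (s.map fun a => 1 - x * a).prod) :
    ∃ N, G.charpoly.roots = s + Multiset.replicate N 0 := by
  classical
  open Polynomial in
  -- The powers of `X` clear the denominators of the substitution `x = t⁻¹`, valid at all `t ≠ 0`.
  have key : X ^ Multiset.card s * G.charpoly =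
      X ^ Fintype.card ι * (s.map fun a => X - C a).prod := by
    refine Polynomial.eq_of_infinite_eval_eq _ _ ((Set.finite_singleton (0 : ℝ)).infinite_compl.mono
      fun t ht => ?_)
    have ht : t ≠ 0 := ht
    have e1 : G.charpoly.eval t = t ^ Fintype.card ι * (s.map fun a => 1 - t⁻¹ * a).prod := by
      rw [← h, ← det_smul, eval_charpoly, smul_sub, smul_smul, mul_inv_cancel₀ ht, one_smul]
      congr 2
      ext i j
      simp [Matrix.scalar_apply, Matrix.one_apply, Matrix.diagonal_apply]
    have e2 : (s.map fun a => t - a).prod =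
        t ^ Multiset.card s * (s.map fun a => 1 - t⁻¹ * a).prod := by
      rw [← Multiset.prod_replicate, ← Multiset.map_const', ← Multiset.prod_map_mul]
      congr 2
      ext a
      field_simp
    simp only [Set.mem_ofPred_eq, eval_mul, eval_pow, eval_X, e1, eval_multiset_prod,
      Multiset.map_map, Function.comp_def, eval_sub, eval_C, e2]
    ring
  have hne : G.charpoly ≠ 0 := G.charpoly_monic.ne_zero
  have hm : (s.map fun a => Polynomial.X - Polynomial.C a).prod ≠ 0 :=
    (Polynomial.monic_multisetProd_X_sub_C s).ne_zero
  have hr := congrArg Polynomial.roots key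
  rw [Polynomial.roots_mul (mul_ne_zero (pow_ne_zero _ Polynomial.X_ne_zero) hne),
    Polynomial.roots_mul (mul_ne_zero (pow_ne_zero _ Polynomial.X_ne_zero) hm),
    Polynomial.roots_X_pow, Polynomial.roots_X_pow, Polynomial.roots_multiset_prod_X_sub_C,
    Multiset.nsmul_singleton, Multiset.nsmul_singleton] at hr
  have hle : Multiset.card s ≤ Fintype.card ι := by
    have := congrArg (Multiset.count 0) hr
    rw [Multiset.count_add, Multiset.count_add, Multiset.count_replicate_self,
      Multiset.count_replicate_self, Multiset.count_eq_zero.2 h0] at this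
    omega
  refine ⟨Fintype.card ι - Multiset.card s, ?_⟩
  have h3 : Multiset.replicate (Fintype.card ι) (0 : ℝ) = Multiset.replicate (Multiset.card s) 0 +
      Multiset.replicate (Fintype.card ι - Multiset.card s) 0 := by
    rw [← Multiset.replicate_add, Nat.add_sub_cancel' hle]
  rw [h3, add_assoc] at hr
  rw [add_left_cancel hr, add_comm]

end Matrix

/-! ### Signs and inner products of faces -/

open Finsupp (single)

variable {n : ℕ}

/-- The sign with which `m / x_j` occurs in the boundary of `m`. -/
def faceSign (m : Mon n) (j : Fin n) : ℝ := (-1) ^ ∑ i ∈ Finset.univ.filter (· < j), m i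

theorem faceSign_mul_self (m : Mon n) (j : Fin n) : faceSign m j * faceSign m j = 1 := by
  rw [faceSign, ← mul_pow]
  simp

theorem faceSign_add_single (m : Mon n) (k j : Fin n) :
    faceSign (m + single k 1) j = if k < j then -faceSign m j else faceSign m j := by
  have : ∑ i ∈ Finset.univ.filter (· < j), (m + single k 1 : Mon n) i =
      (∑ i ∈ Finset.univ.filter (· < j), m i) + if k < j then 1 else 0 := by
    simp [Finset.sum_add_distrib, Finsupp.single_apply]
  rw [faceSign, faceSign, this]
  split_ifs <;> simp [pow_succ]

open Classical in
/-- The inner product of the terms `± a / x_i` and `± b / x_j` of the boundaries of `a`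
and `b`. -/
noncomputable def faceInner (i j : Fin n) (a b : Mon n) : ℝ :=
  if Odd (a i) ∧ Odd (b j) ∧ a + single j 1 = b + single i 1 then faceSign a i * faceSign b j else 0

theorem faceInner_comm (i j : Fin n) (a b : Mon n) : faceInner i j a b = faceInner j i b a := by
  unfold faceInner
  refine if_congr ?_ (mul_comm _ _) rfl
  rw [eq_comm (a := b + _)]
  tauto

theorem faceInner_self (i : Fin n) {a : Mon n} (ha : Odd (a i)) (b : Mon n) :
    faceInner i i a b = if a = b then 1 else 0 := by
  unfold faceInner
  by_cases h : a = b
  · subst h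
    simp [ha, faceSign_mul_self]
  · simp [h]

theorem faceInner_eq_zero {i j : Fin n} {a b : Mon n}
    (h : Odd (a i) → Odd (b j) → a + single j 1 ≠ b + single i 1) : faceInner i j a b = 0 :=
  if_neg fun ⟨h1, h2, h3⟩ => h h1 h2 h3

theorem apply_eq_of_add_single_eq {i j k : Fin n} {a b : Mon n}
    (h : a + single j 1 = b + single i 1) :
    a k + (if j = k then 1 else 0) = b k + if i = k then 1 else 0 := by
  simpa [Finsupp.single_apply] using DFunLike.congr_fun h k

/-! ### Gram matrices of shifted families -/

section family

variable {ι : Type*}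

/-- The Gram matrix of the boundaries, restricted to the variables in `V`, of a family of
monomials. -/
noncomputable def boundaryGram (V : Finset (Fin n)) (φ : ι → Mon n) : Matrix ι ι ℝ :=
  Matrix.of fun a b => ∑ i ∈ V, ∑ j ∈ V, faceInner i j (φ a) (φ b)

/-- Shiftedness, relative to the variables in `V`, of a family of monomials. -/
def IsShiftedFamily (V : Finset (Fin n)) (φ : ι → Mon n) : Prop :=
  ∀ a, ∀ i ∈ V, ∀ j ∈ V, i < j → Odd (φ a j) → ¬Odd (φ a i) →
    ∃ b, φ b + single j 1 = φ a + single i 1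

/-- The number of members of a family of monomials in which the exponent of `x_j` is odd. -/
def oddCount [Fintype ι] (φ : ι → Mon n) (j : Fin n) : ℕ :=
  Fintype.card {a // Odd (φ a j)}

theorem boundaryGram_isSymm (V : Finset (Fin n)) (φ : ι → Mon n) : (boundaryGram V φ).IsSymm := by
  ext a b
  simp only [Matrix.transpose_apply, boundaryGram, Matrix.of_apply]
  rw [Finset.sum_comm]
  simp_rw [faceInner_comm _ _ (φ b)]

theorem IsShiftedFamily.mono {V W : Finset (Fin n)} {φ : ι → Mon n} (h : IsShiftedFamily W φ)
    (hVW : V ⊆ W) : IsShiftedFamily V φ :=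
  fun a i hi j hj => h a i (hVW hi) j (hVW hj)

/-- Exchanges within `V` do not touch the exponent of `x_k`, so both parity classes inherit
shiftedness. -/
theorem IsShiftedFamily.subtype {V : Finset (Fin n)} {φ : ι → Mon n} (h : IsShiftedFamily V φ)
    {k : Fin n} (hk : k ∉ V) (p : ℕ → Prop) :
    IsShiftedFamily V (fun a : {a // p (φ a k)} => φ a) := by
  intro a i hi j hj hij h1 h2
  obtain ⟨b, hb⟩ := h a i hi j hj hij h1 h2
  have := apply_eq_of_add_single_eq (k := k) hb
  rw [if_neg (by rintro rfl; exact hk hj), if_neg (by rintro rfl; exact hk hi)] at this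
  exact ⟨⟨b, by simpa [show φ b k = φ a k from this] using a.2⟩, hb⟩

theorem IsShiftedFamily.oddCount_le [Fintype ι] {V : Finset (Fin n)} {φ : ι → Mon n}
    (h : IsShiftedFamily V φ) (hφ : Function.Injective φ) {i j : Fin n} (hi : i ∈ V) (hj : j ∈ V)
    (hij : i < j) : oddCount φ j ≤ oddCount φ i := by
  classical
  have key : ∀ a : {a // Odd (φ a j)}, ∃ b : {b // Odd (φ b i)},
      (Odd (φ a i) ∧ b.1 = a.1) ∨
        (¬ Odd (φ a i) ∧ ¬ Odd (φ b j) ∧ φ b + single j 1 = φ a + single i 1) := by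
    intro a
    by_cases ha : Odd (φ a i)
    · exact ⟨⟨a, ha⟩, Or.inl ⟨ha, rfl⟩⟩
    · obtain ⟨b, hb⟩ := h a i hi j hj hij a.2 ha
      have h1 := apply_eq_of_add_single_eq (k := i) hb
      have h2 := apply_eq_of_add_single_eq (k := j) hb
      have h3 := a.2
      simp only [if_neg hij.ne, if_neg hij.ne', if_true] at h1 h2
      refine ⟨⟨b, ?_⟩, Or.inr ⟨ha, ?_, hb⟩⟩ <;> grind
  choose f hf using key
  refine Fintype.card_le_of_injective f fun a b hab => ?_
  have h1 := hf a
  have h2 := hf b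
  rw [hab] at h1
  have ha := a.2
  have hb := b.2
  rcases h1 with ⟨h1, h1'⟩ | ⟨h1, h1', h1''⟩ <;> rcases h2 with ⟨h2, h2'⟩ | ⟨h2, h2', h2''⟩
  · exact Subtype.ext (h1'.symm.trans h2')
  · rw [h1'] at h2'; exact absurd ha h2'
  · rw [h2'] at h1'; exact absurd hb h1'
  · exact Subtype.ext (hφ (add_right_cancel (h1''.symm.trans h2'')))

/-- The block of the Gram matrix between the monomials with odd and with even exponent
of `x_i`. -/
noncomputable def coneBlock (i : Fin n) (V : Finset (Fin n)) (φ : ι → Mon n) :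
    Matrix {a // Odd (φ a i)} {a // ¬Odd (φ a i)} ℝ :=
  Matrix.of fun a d => ∑ j ∈ V, faceInner i j (φ a) (φ d)

/-- Comparing exponents of `x_i` decides which faces can coincide. Two odd monomials share an
`x_i`-face only if equal, whence the `1`; an `x_i`-face of an odd monomial has even exponent, so it
can only meet a `V`-face of an even one. -/
theorem boundaryGram_submatrix [DecidableEq ι] {i : Fin n} {V : Finset (Fin n)} (hi : i ∉ V)
    {φ : ι → Mon n} (hφ : Function.Injective φ) :
    (boundaryGram (insert i V) φ).submatrix (Equiv.sumCompl fun a => Odd (φ a i))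
        (Equiv.sumCompl fun a => Odd (φ a i)) =
      Matrix.fromBlocks (1 + boundaryGram V fun a : {a // Odd (φ a i)} => φ a) (coneBlock i V φ)
        (coneBlock i V φ).transpose (boundaryGram V fun a : {a // ¬Odd (φ a i)} => φ a) := by
  have expand : ∀ a b, boundaryGram (insert i V) φ a b =
      faceInner i i (φ a) (φ b) + ∑ j ∈ V, faceInner i j (φ a) (φ b) +
        (∑ j ∈ V, faceInner j i (φ a) (φ b) + boundaryGram V φ a b) := by
    intro a b
    simp only [boundaryGram, Matrix.of_apply, Finset.sum_insert hi, Finset.sum_add_distrib]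
  have hne : ∀ j ∈ V, j ≠ i := by
    rintro j hj rfl
    exact hi hj
  have AD : ∀ (a : {a // Odd (φ a i)}) (d : {a // ¬Odd (φ a i)}),
      boundaryGram (insert i V) φ a d = coneBlock i V φ a d := by
    intro a d
    rw [expand, faceInner_eq_zero fun _ h => absurd h d.2,
      Finset.sum_eq_zero fun j _ => faceInner_eq_zero fun _ h => absurd h d.2]
    have : boundaryGram V φ a d = 0 := by
      refine Finset.sum_eq_zero fun j hj => Finset.sum_eq_zero fun k hk =>
        faceInner_eq_zero fun _ _ h => d.2 ?_
      have := apply_eq_of_add_single_eq (k := i) h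
      rw [if_neg (hne _ hk), if_neg (hne _ hj)] at this
      rw [← show φ a i = φ d i from this]
      exact a.2
    rw [this, zero_add, add_zero, add_zero]
    rfl
  ext (a | a) (b | b)
  · simp only [Matrix.submatrix_apply, Equiv.sumCompl_apply_inl, Matrix.fromBlocks_apply₁₁]
    rw [expand, faceInner_self i a.2]
    have parity : ∀ a b : {a // Odd (φ a i)}, ∀ j ∈ V, faceInner i j (φ a) (φ b) = 0 := by
      refine fun a b j hj => faceInner_eq_zero fun _ _ h => ?_
      have := apply_eq_of_add_single_eq (k := i) h
      rw [if_neg (hne _ hj), if_pos rfl] at this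
      have h1 := a.2
      have h2 := b.2
      grind
    rw [Finset.sum_eq_zero (parity a b),
      Finset.sum_eq_zero fun j hj => (faceInner_comm _ _ _ _).trans (parity b a j hj), add_zero,
      zero_add, Matrix.add_apply, Matrix.one_apply]
    congr 1
    exact if_congr (hφ.eq_iff.trans Subtype.ext_iff.symm) rfl rfl
  · exact AD a b
  · exact ((boundaryGram_isSymm _ φ).apply _ _).symm.trans (AD b a)
  · simp only [Matrix.submatrix_apply, Equiv.sumCompl_apply_inr, Matrix.fromBlocks_apply₂₂]
    rw [expand, faceInner_eq_zero fun h => absurd h a.2,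
      Finset.sum_eq_zero fun j _ => faceInner_eq_zero fun h => absurd h a.2,
      Finset.sum_eq_zero fun j _ => faceInner_eq_zero fun _ h => absurd h b.2, zero_add, zero_add,
      zero_add]
    rfl

/-- Each `V`-face of an even monomial is thus also the `x_i`-face of an odd one: the family is
cone-like with apex `x_i`. -/
theorem IsShiftedFamily.exists_cone {i j : Fin n} {V : Finset (Fin n)} {φ : ι → Mon n}
    (h : IsShiftedFamily (insert i V) φ) (hiV : ∀ j ∈ V, i < j) (hj : j ∈ V)
    (d : {a // ¬Odd (φ a i)}) (hd : Odd (φ d j)) :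
    ∃ a : {a // Odd (φ a i)}, φ a + single j 1 = φ d + single i 1 := by
  obtain ⟨b, hb⟩ := h d i (Finset.mem_insert_self _ _) j (Finset.mem_insert_of_mem hj)
    (hiV j hj) hd d.2
  have := apply_eq_of_add_single_eq (k := i) hb
  rw [if_neg (hiV j hj).ne', if_pos rfl] at this
  have h1 := d.2
  exact ⟨⟨b, by grind⟩, hb⟩

/-- Expanding the product, each face `d / x_j` is the `x_i`-face of exactly one odd member, whose
sign enters twice and cancels. -/
theorem coneBlock_transpose_mul [Fintype ι] [DecidableEq ι] {i : Fin n} {V : Finset (Fin n)}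
    {φ : ι → Mon n} (h : IsShiftedFamily (insert i V) φ) (hφ : Function.Injective φ)
    (hiV : ∀ j ∈ V, i < j) :
    (coneBlock i V φ).transpose * coneBlock i V φ =
      boundaryGram V fun a : {a // ¬Odd (φ a i)} => φ a := by
  ext d e
  simp only [Matrix.mul_apply, Matrix.transpose_apply, coneBlock, boundaryGram, Matrix.of_apply,
    Finset.sum_mul_sum]
  rw [Finset.sum_comm]
  refine Finset.sum_congr rfl fun j hj => ?_
  rw [Finset.sum_comm]
  refine Finset.sum_congr rfl fun k hk => ?_
  by_cases hd : Odd (φ d j)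
  · obtain ⟨a, ha⟩ := h.exists_cone hiV hj d hd
    rw [Finset.sum_eq_single a]
    · have e1 : faceInner i j (φ a) (φ d) = faceSign (φ a) i * faceSign (φ d) j :=
        if_pos ⟨a.2, hd, ha⟩
      have e2 : φ a + single k 1 = φ e + single i 1 ↔ φ d + single k 1 = φ e + single j 1 := by
        rw [← add_left_inj (single j 1), add_right_comm, ha, add_right_comm, add_right_comm (φ e),
          add_left_inj]
      rw [e1]
      unfold faceInner
      simp only [a.2, hd, e2, true_and, mul_ite, mul_zero]
      congr 1
      linear_combination (faceSign (φ d) j * faceSign (φ e) k) * faceSign_mul_self (φ a) i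
    · intro b _ hb
      rw [faceInner_eq_zero, zero_mul]
      intro _ _ h3
      exact hb (Subtype.ext (hφ (add_right_cancel (h3.trans ha.symm))))
    · simp
  · rw [faceInner_eq_zero fun h => absurd h hd]
    exact Finset.sum_eq_zero fun a _ => by
      rw [faceInner_eq_zero fun _ h => absurd h hd, zero_mul]

/-- Only `b = x_i d / x_l` can contribute. The result is symmetric in `k` and `l` except for its
last factor, which changes sign when distinct `k` and `l` are swapped. -/
theorem sum_faceInner_mul_faceInner [Fintype ι] [DecidableEq ι] {i j k l : Fin n}
    {V : Finset (Fin n)} {φ : ι → Mon n} (h : IsShiftedFamily (insert i V) φ)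
    (hφ : Function.Injective φ) (hiV : ∀ j ∈ V, i < j) (hk : k ∈ V) (hl : l ∈ V) (m : Mon n)
    (d : {a // ¬Odd (φ a i)}) [Decidable (m + single k 1 + single l 1 = φ d + single i 1 + single j 1)] :
    ∑ b : {a // Odd (φ a i)}, faceInner j k m (φ b) * faceInner i l (φ b) (φ d) =
      if Odd (m j) ∧ Odd (φ d k) ∧ Odd (φ d l) ∧ k ≠ l ∧
          m + single k 1 + single l 1 = φ d + single i 1 + single j 1 then
        faceSign m j * faceSign (φ d) i * faceSign (φ d) k * faceSign (φ d) l *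
          (if l < k then 1 else -1)
      else 0 := by
  by_cases hd : Odd (φ d l)
  · obtain ⟨a, ha⟩ := h.exists_cone hiV hl d hd
    have hik := hiV k hk
    have hil := hiV l hl
    rw [Finset.sum_eq_single a]
    · have e1 : faceInner i l (φ a) (φ d) = faceSign (φ a) i * faceSign (φ d) l :=
        if_pos ⟨a.2, hd, ha⟩
      have e2 : m + single k 1 = φ a + single j 1 ↔
          m + single k 1 + single l 1 = φ d + single i 1 + single j 1 := by
        rw [← add_left_inj (single l 1), add_right_comm (φ a), ha]
      have e3 : Odd (φ a k) ↔ Odd (φ d k) ∧ k ≠ l := by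
        have := apply_eq_of_add_single_eq (k := k) ha
        rw [if_neg hik.ne] at this
        by_cases hkl : l = k
        · subst hkl
          rw [if_pos rfl] at this
          simp only [ne_eq, not_true_eq_false, and_false, iff_false]
          grind
        · rw [if_neg hkl] at this
          rw [show φ a k = φ d k from this]
          simp [Ne.symm hkl]
      have e4 : faceSign (φ a) i = faceSign (φ d) i := by
        have := faceSign_add_single (φ a) l i
        rwa [ha, faceSign_add_single, if_neg (lt_irrefl i), if_neg hil.not_gt, eq_comm] at this
      -- Since `i < k`, adding `x_i` flips the sign; removing `x_l` flips it back exactly when `l <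
      -- k`.
      have e5 : faceSign (φ a) k = faceSign (φ d) k * if l < k then 1 else -1 := by
        have := faceSign_add_single (φ a) l k
        rw [ha, faceSign_add_single, if_pos hik] at this
        split_ifs at this ⊢ <;> linarith
      rw [e1]
      unfold faceInner
      rw [ite_mul, zero_mul, e4, e5]
      refine if_congr ?_ (by ring) rfl
      rw [e2, e3]
      tauto
    · intro b _ hb
      rw [faceInner_eq_zero (i := i), mul_zero]
      intro _ _ h3
      exact hb (Subtype.ext (hφ (add_right_cancel (h3.trans ha.symm))))
    · simp
  · rw [if_neg (by tauto)]
    exact Finset.sum_eq_zero fun a _ => by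
      rw [faceInner_eq_zero (i := i) fun _ h => absurd h hd, mul_zero]

theorem boundaryGram_mul_coneBlock [Fintype ι] [DecidableEq ι] {i : Fin n} {V : Finset (Fin n)}
    {φ : ι → Mon n} (h : IsShiftedFamily (insert i V) φ) (hφ : Function.Injective φ)
    (hiV : ∀ j ∈ V, i < j) :
    (boundaryGram V fun a : {a // Odd (φ a i)} => φ a) * coneBlock i V φ = 0 := by
  classical
  ext c d
  simp only [Matrix.mul_apply, coneBlock, boundaryGram, Matrix.of_apply, Finset.sum_mul,
    Matrix.zero_apply]
  rw [Finset.sum_comm]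
  refine Finset.sum_eq_zero fun j _ => ?_
  simp only [Finset.mul_sum]
  rw [Finset.sum_comm]
  have swap : ∑ k ∈ V, ∑ b : {a // Odd (φ a i)}, ∑ l ∈ V,
      faceInner j k (φ c) (φ b) * faceInner i l (φ b) (φ d) =
      ∑ k ∈ V, ∑ l ∈ V, ∑ b : {a // Odd (φ a i)},
        faceInner j k (φ c) (φ b) * faceInner i l (φ b) (φ d) :=
    Finset.sum_congr rfl fun k _ => Finset.sum_comm
  rw [swap]
  set S := ∑ k ∈ V, ∑ l ∈ V, ∑ b : {a // Odd (φ a i)},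
    faceInner j k (φ c) (φ b) * faceInner i l (φ b) (φ d) with hS
  -- Removing `x_k` and `x_l` in either order gives opposite signs, as in `∂∂ = 0`.
  have anti : S = -S := by
    conv_lhs => rw [hS, Finset.sum_comm]
    rw [hS, ← Finset.sum_neg_distrib]
    refine Finset.sum_congr rfl fun k hk => ?_
    rw [← Finset.sum_neg_distrib]
    refine Finset.sum_congr rfl fun l hl => ?_
    rw [sum_faceInner_mul_faceInner h hφ hiV hk hl, sum_faceInner_mul_faceInner h hφ hiV hl hk,
      add_right_comm (φ c)]
    by_cases hkl : k = l
    · subst hkl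
      simp
    · have hlt : (if k < l then (1 : ℝ) else -1) = -if l < k then 1 else -1 := by
        rcases lt_or_gt_of_ne hkl with hlt | hlt <;> simp [hlt, hlt.not_gt]
      rw [hlt]
      split_ifs <;> first | ring1 | (exfalso; tauto)
  linarith

end family

/-- The spectrum of a shifted family of monomials. -/
theorem exists_spectrum (l : List (Fin n)) (hl : l.Pairwise (· < ·)) {ι : Type*} [Fintype ι]
    [DecidableEq ι] (φ : ι → Mon n) (hφ : Function.Injective φ)
    (h : IsShiftedFamily l.toFinset φ) :
    ∃ s : Multiset ℕ, 0 ∉ s ∧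
      (∀ x : ℝ, (1 - x • boundaryGram l.toFinset φ).det = (s.map fun a : ℕ => 1 - x * a).prod) ∧
      ∀ c, s.countP (c < ·) = (l.map (oddCount φ)).getD c 0 := by
  induction l generalizing ι with
  | nil =>
    refine ⟨0, by simp, fun x => ?_, by simp⟩
    have : boundaryGram (∅ : Finset (Fin n)) φ = 0 := by
      ext a b
      simp [boundaryGram]
    simp [this]
  | cons i l ih =>
    obtain ⟨hil, hl⟩ := List.pairwise_cons.1 hl
    rw [List.toFinset_cons] at h ⊢
    have hiV : ∀ j ∈ l.toFinset, i < j := fun j hj => hil j (List.mem_toFinset.1 hj)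
    have hi : i ∉ l.toFinset := fun hi => lt_irrefl _ (hiV i hi)
    have hV := h.mono (Finset.subset_insert _ _)
    obtain ⟨s, hs0, hs, hsc⟩ := ih hl (fun a : {a // Odd (φ a i)} => φ a)
      (hφ.comp Subtype.val_injective) (hV.subtype hi Odd)
    obtain ⟨t, ht0, ht, htc⟩ := ih hl (fun a : {a // ¬Odd (φ a i)} => φ a)
      (hφ.comp Subtype.val_injective) (hV.subtype hi fun m => ¬Odd m)
    have count_add : ∀ j, oddCount (fun a : {a // Odd (φ a i)} => φ a) j +
        oddCount (fun a : {a // ¬Odd (φ a i)} => φ a) j = oddCount φ j := by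
      intro j
      unfold oddCount
      rw [← Fintype.card_sum]
      refine Fintype.card_congr ?_
      exact ((Equiv.subtypeSum (p := fun x => Odd (φ (Equiv.sumCompl (fun a => Odd (φ a i)) x) j))).symm.trans
        (Equiv.subtypeEquiv (Equiv.sumCompl fun a => Odd (φ a i)) fun _ => Iff.rfl))
    have countP_add : ∀ c, (s + t).countP (c < ·) = (l.map (oddCount φ)).getD c 0 := by
      intro c
      rw [Multiset.countP_add, hsc, htc]
      by_cases hc : c < l.length
      · simp [hc, count_add]
      · simp [hc]
    have hpos : ∀ {u : Multiset ℕ}, 0 ∉ u → u.countP (0 < ·) = Multiset.card u := fun hu =>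
      Multiset.countP_eq_card.2 fun a ha => Nat.pos_of_ne_zero fun h0 => hu (h0 ▸ ha)
    have hst0 : 0 ∉ s + t := by simp [hs0, ht0]
    -- The number of eigenvalues inherited from the halves is the odd count of the next variable, at
    -- most that of `x_i` by shiftedness; so padding is possible.
    have hle : Multiset.card (s + t) ≤ oddCount φ i := by
      rw [← hpos hst0, countP_add]
      cases l with
      | nil => simp
      | cons j l =>
        exact h.oddCount_le hφ (by simp) (by simp) (hil j (by simp))
    obtain ⟨N, hN⟩ := Nat.exists_eq_add_of_le hle
    refine ⟨(s + t).map Nat.succ + Multiset.replicate N 1, ?_, ?_, ?_⟩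
    · simp [Multiset.mem_replicate]
    -- The substitution `y = x / (1 - x)` fails at `x = 1`, which continuity recovers. Elsewhere `(1
    -- - x)(1 - y a) = 1 - x (a + 1)`, so eigenvalues rise by one.
    · have hcont : Continuous fun x : ℝ =>
          (((s + t).map Nat.succ + Multiset.replicate N 1).map fun a : ℕ => 1 - x * (a : ℝ)).prod :=
        continuous_multiset_prod _ fun a _ => by fun_prop
      refine congrFun ((Matrix.continuous_det_one_sub_smul _).ext_on
        (dense_compl_singleton (1 : ℝ)) hcont fun x hx => ?_)
      have hx : x ≠ 1 := hx
      have hx' : 1 - x ≠ 0 := sub_ne_zero.2 hx.symm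
      have e1 : (1 - x • boundaryGram (insert i l.toFinset) φ).det =
          (1 - x • (boundaryGram (insert i l.toFinset) φ).submatrix
            (Equiv.sumCompl fun a => Odd (φ a i)) (Equiv.sumCompl fun a => Odd (φ a i))).det := by
        rw [← Matrix.det_submatrix_equiv_self (Equiv.sumCompl fun a => Odd (φ a i))]
        congr 1
        ext a b
        simp [Matrix.one_apply]
      have e2 : (((s + t).map Nat.succ).map fun a : ℕ => 1 - x * (a : ℝ)).prod =
          (1 - x) ^ Multiset.card (s + t) *
            ((s + t).map fun a : ℕ => 1 - x / (1 - x) * (a : ℝ)).prod := by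
        rw [← Multiset.prod_replicate, ← Multiset.map_const', ← Multiset.prod_map_mul,
          Multiset.map_map]
        congr 1
        refine Multiset.map_congr rfl fun a _ => ?_
        simp only [Function.comp_apply, Nat.succ_eq_add_one]
        push_cast
        field_simp
        ring
      simp only
      rw [e1, boundaryGram_submatrix hi hφ, ← coneBlock_transpose_mul h hφ hiV,
        Matrix.det_one_sub_smul_fromBlocks (boundaryGram_isSymm _ _)
          (boundaryGram_mul_coneBlock h hφ hiV) hx, coneBlock_transpose_mul h hφ hiV, hs, ht,
        Multiset.map_add _ (Multiset.map _ _), Multiset.prod_add, e2, Multiset.map_add,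
        Multiset.prod_add, Multiset.map_replicate, Multiset.prod_replicate]
      rw [show Fintype.card {a // Odd (φ a i)} = Multiset.card (s + t) + N from hN, pow_add]
      push_cast
      ring
    · intro c
      rw [Multiset.countP_add, Multiset.countP_map, ← Multiset.countP_eq_card_filter]
      cases c with
      | zero =>
        have h1 : (s + t).countP (fun a => 0 < a.succ) = Multiset.card (s + t) :=
          Multiset.countP_eq_card.2 fun a _ => a.succ_pos
        rw [h1, Multiset.countP_eq_card.2 fun a ha => by
          rw [Multiset.eq_of_mem_replicate ha]; exact one_pos, Multiset.card_replicate, ← hN]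
        simp
      | succ c =>
        simp only [Nat.succ_eq_add_one, Nat.add_lt_add_iff_right, List.map_cons,
          List.getD_cons_succ, countP_add]
        rw [Multiset.countP_eq_zero.2 (by simp [Multiset.mem_replicate]), add_zero]

/-! ### Multicomplexes and their square-free pieces -/

open Classical in
theorem boundary_single_apply {V : Finset (Fin n)} {m : Mon n} (hV : ∀ j, j ∉ V → m j = 0)
    (t : Mon n) :
    boundary n (single m 1) t =
      ∑ j ∈ V, if Odd (m j) ∧ t + single j 1 = m then faceSign m j else 0 := by
  simp only [boundary, Finsupp.linearCombination_single, one_smul, Finsupp.finsetSum_apply]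
  rw [← Finset.sum_subset (Finset.subset_univ V) fun j _ hj => by simp [hV j hj]]
  refine Finset.sum_congr rfl fun j _ => ?_
  by_cases hj : Odd (m j)
  · have hle : single j 1 ≤ m := by
      rw [Finsupp.single_le_iff]
      exact hj.pos
    have : m - single j 1 = t ↔ t + single j 1 = m := by
      rw [tsub_eq_iff_eq_add_of_le hle, eq_comm]
    rw [if_pos hj, Finsupp.single_apply]
    simp only [this, hj, true_and]
    rfl
  · simp [hj]

namespace Multicomplex

theorem mem_graded {M : Multicomplex n} {d : ℕ} {m : Mon n} :
    m ∈ M.graded d ↔ m ∈ M.carrier ∧ m.degree = d :=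
  Finset.mem_filter

theorem apply_eq_zero_of_notMem_vertices (M : Multicomplex n) {m : Mon n} (hm : m ∈ M.carrier)
    {j : Fin n} (hj : j ∉ M.vertices) : m j = 0 := by
  by_contra h
  refine hj (M.down_closed _ _ ?_ hm)
  rw [Finsupp.single_le_iff]
  omega

/-- Closure under divisors puts every face in `M_d`, so summing over `M_d` detects each coincidence
of faces once. -/
theorem transpose_boundaryMatrix_mul (M : Multicomplex n) (d : ℕ) {V : Finset (Fin n)}
    (hV : M.vertices ⊆ V) :
    (M.boundaryMatrix d).transpose * M.boundaryMatrix d =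
      boundaryGram V (Subtype.val : M.graded (d + 1) → Mon n) := by
  classical
  have h0 : ∀ (m : M.graded (d + 1)) j, j ∉ V → m.1 j = 0 := fun m j hj =>
    M.apply_eq_zero_of_notMem_vertices (mem_graded.1 m.2).1 fun h => hj (hV h)
  ext a b
  simp only [Matrix.mul_apply, Matrix.transpose_apply, boundaryMatrix, boundaryGram,
    Matrix.of_apply, boundary_single_apply (h0 _), Finset.sum_mul_sum]
  rw [Finset.sum_comm]
  refine Finset.sum_congr rfl fun i _ => ?_
  rw [Finset.sum_comm]
  refine Finset.sum_congr rfl fun j _ => ?_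
  by_cases ha : Odd (a.1 i)
  · obtain ⟨t, ht⟩ : ∃ t : Mon n, t + single i 1 = a.1 :=
      ⟨a.1 - single i 1, tsub_add_cancel_of_le (Finsupp.single_le_iff.2 ha.pos)⟩
    obtain ⟨haM, had⟩ := mem_graded.1 a.2
    have htM : t ∈ M.graded d := by
      refine mem_graded.2 ⟨M.down_closed _ _ (ht ▸ le_self_add) haM, ?_⟩
      rw [← ht, map_add, Finsupp.degree_single] at had
      omega
    rw [Finset.sum_eq_single ⟨t, htM⟩]
    · have : a.1 + single j 1 = b.1 + single i 1 ↔ t + single j 1 = b.1 := by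
        rw [← ht, add_right_comm, add_left_inj]
      unfold faceInner
      simp only [ha, ht, this, true_and, if_true, mul_ite, mul_zero]
    · intro s _ hs
      rw [if_neg, zero_mul]
      rintro ⟨_, h⟩
      exact hs (Subtype.ext (add_right_cancel (h.trans ht.symm)))
    · simp
  · rw [faceInner_eq_zero fun h => absurd h ha]
    exact Finset.sum_eq_zero fun t _ => by rw [if_neg fun h => ha h.1, zero_mul]

/-- Only even exponents at `i` are needed, which lets the lemma apply to square-free pieces, where
`x_i` cannot be added twice. -/
theorem graded_isShiftedFamily {M : Multicomplex n} {V : Finset (Fin n)}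
    (h : ∀ m : Mon n, ∀ i ∈ V, ∀ j, i < j → single j 1 + m ∈ M.carrier → ¬Odd (m i) →
      single i 1 + m ∈ M.carrier) (d : ℕ) :
    IsShiftedFamily V (Subtype.val : M.graded d → Mon n) := by
  intro a i hi j _ hij hj hai
  obtain ⟨haM, had⟩ := mem_graded.1 a.2
  obtain ⟨m, hm⟩ : ∃ m : Mon n, single j 1 + m = a.1 :=
    ⟨a.1 - single j 1, add_tsub_cancel_of_le (Finsupp.single_le_iff.2 hj.pos)⟩
  refine ⟨⟨single i 1 + m, mem_graded.2 ⟨h m i hi j hij (hm ▸ haM) ?_, ?_⟩⟩, ?_⟩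
  · rw [← hm, Finsupp.add_apply, Finsupp.single_eq_of_ne hij.ne, zero_add] at hai
    exact hai
  · rw [← hm] at had
    simpa [Finsupp.degree_single] using had
  · simp only [← hm]
    abel

theorem oddCount_graded (M : Multicomplex n) (d : ℕ) (j : Fin n) :
    oddCount (Subtype.val : M.graded d → Mon n) j = M.paritySum d j := by
  rw [paritySum, Finset.sum_apply, oddCount, Fintype.card_subtype, Finset.card_filter,
    Finset.sum_coe_sort (M.graded d) fun m => if Odd (m j) then 1 else 0]
  refine Finset.sum_congr rfl fun m _ => ?_
  split_ifs with h <;> grind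

theorem paritySum_antitoneOn {M : Multicomplex n} {V : Finset (Fin n)} {d : ℕ}
    (h : IsShiftedFamily V (Subtype.val : M.graded d → Mon n)) :
    AntitoneOn (M.paritySum d) V := by
  intro i hi j hj hij
  rcases hij.eq_or_lt with rfl | hij
  · exact le_rfl
  · rw [← oddCount_graded, ← oddCount_graded]
    exact h.oddCount_le Subtype.val_injective hi hj hij

theorem paritySum_eq_zero {M : Multicomplex n} (d : ℕ) {j : Fin n} (hj : j ∉ M.vertices) :
    M.paritySum d j = 0 := by
  rw [paritySum, Finset.sum_apply]
  exact Finset.sum_eq_zero fun m hm => by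
    rw [M.apply_eq_zero_of_notMem_vertices (mem_graded.1 hm).1 hj, Nat.zero_mod]

theorem mem_piece {M : Multicomplex n} {p q : Mon n} :
    q ∈ (M.piece p).carrier ↔ 2 • p + q ∈ M.carrier ∧ ∀ i, q i ≤ 1 := by
  refine Finset.mem_filter.trans ⟨fun h => h.2, fun h => ⟨?_, h⟩⟩
  exact M.down_closed _ _ le_add_self h.1

theorem vertices_piece_subset (M : Multicomplex n) (p : Mon n) :
    (M.piece p).vertices ⊆ M.vertices :=
  fun _ hi => (Finset.mem_filter.1 hi).1

theorem degreeSequence_piece (M : Multicomplex n) (p : Mon n) (d : ℕ) :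
    (M.piece p).degreeSequence d = (M.piece p).paritySum d := by
  ext j
  rw [paritySum, Finset.sum_apply, degreeSequence, Finset.card_filter]
  refine Finset.sum_congr rfl fun m hm => ?_
  have := (mem_piece.1 (mem_graded.1 hm).1).2 j
  simp only [Finsupp.single_le_iff]
  split_ifs <;> omega

theorem IsShifted.piece_graded {M : Multicomplex n} (hM : M.IsShifted) {V : Finset (Fin n)}
    (hV : (V : Set (Fin n)) ⊆ M.vertices) (p : Mon n) (d : ℕ) :
    IsShiftedFamily V (Subtype.val : (M.piece p).graded d → Mon n) := by
  refine graded_isShiftedFamily (fun m i hi j hij hm hodd => ?_) d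
  obtain ⟨h1, h2⟩ := mem_piece.1 hm
  refine mem_piece.2 ⟨?_, fun k => ?_⟩
  · rw [add_left_comm] at h1 ⊢
    exact hM _ i j h1 hij (hV hi)
  · have hk := h2 k
    have hi := h2 i
    simp only [Finsupp.add_apply, Finsupp.single_apply] at hk hi ⊢
    split_ifs at hk hi ⊢ with h3 h4 <;> subst_vars <;> grind

/-- Each `α` is uniquely `p² q` with `q` square-free, and `α` and `q` have the same parities. The
bound `2 deg p ≤ k` omits only the squares `q = 1`, which contribute zero. -/
theorem paritySum_eq_sum_piece (M : Multicomplex n) (k : ℕ) (j : Fin n) :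
    M.paritySum (k + 1) j = ∑ p ∈ M.squareRoots.filter (fun p => 2 * p.degree ≤ k),
      (M.piece p).paritySum (k + 1 - 2 * p.degree) j := by
  simp only [paritySum, Finset.sum_apply]
  rw [Finset.sum_sigma']
  symm
  refine Finset.sum_of_injOn (fun x : (_ : Mon n) × Mon n => 2 • x.1 + x.2) ?_ ?_ ?_ ?_
  · rintro ⟨p, q⟩ hx ⟨p', q'⟩ hy h
    have hq := (mem_piece.1 (mem_graded.1 (Finset.mem_sigma.1 hx).2).1).2
    have hq' := (mem_piece.1 (mem_graded.1 (Finset.mem_sigma.1 hy).2).1).2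
    have hp : ∀ i, p i = p' i ∧ q i = q' i := fun i => by
      have h1 := DFunLike.congr_fun h i
      have h2 := hq i
      have h3 := hq' i
      simp only [Finsupp.add_apply, Finsupp.smul_apply, smul_eq_mul] at h1 h2 h3
      omega
    obtain rfl : p = p' := Finsupp.ext fun i => (hp i).1
    obtain rfl : q = q' := Finsupp.ext fun i => (hp i).2
    rfl
  · rintro ⟨p, q⟩ hx
    obtain ⟨hp, hq⟩ := Finset.mem_sigma.1 hx
    obtain ⟨hq, hd⟩ := mem_graded.1 hq
    have hp := (Finset.mem_filter.1 hp).2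
    refine mem_graded.2 ⟨(mem_piece.1 hq).1, ?_⟩
    simp only at hd hp ⊢
    rw [map_add, map_nsmul, smul_eq_mul, hd]
    omega
  · intro α hα himg
    by_contra hodd
    obtain ⟨hαM, hαd⟩ := mem_graded.1 hα
    let p : Mon n := α.mapRange (· / 2) (by simp)
    let q : Mon n := α.mapRange (· % 2) (by simp)
    have hpq : 2 • p + q = α := by
      ext i
      simp only [p, q, Finsupp.add_apply, Finsupp.smul_apply, smul_eq_mul, Finsupp.mapRange_apply]
      omega
    have hdeg : 2 * p.degree + q.degree = k + 1 := by
      rw [← hαd, ← hpq, map_add, map_nsmul, smul_eq_mul]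
    have hq : 0 < q.degree := by
      have : q j ≤ q.degree := Finsupp.le_degree j q
      simp only [q, Finsupp.mapRange_apply] at this ⊢
      omega
    refine himg ⟨⟨p, q⟩, Finset.mem_sigma.2 ⟨Finset.mem_filter.2 ⟨?_, ?_⟩, mem_graded.2 ⟨?_, ?_⟩⟩,
      hpq⟩
    · rw [mem_squareRoots]
      exact M.down_closed _ _ (hpq ▸ le_self_add) hαM
    · simp only
      omega
    · refine mem_piece.2 ⟨hpq.symm ▸ hαM, fun i => ?_⟩
      simp only [q, Finsupp.mapRange_apply]
      omega
    · simp only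
      omega
  · rintro ⟨p, q⟩ -
    simp [Finsupp.add_apply]

theorem upLaplacian_charpoly (M : Multicomplex n) (k : ℕ) :
    (M.upLaplacian k).charpoly =
      (M.boundaryMatrix k * (M.boundaryMatrix k).transpose).charpoly := by
  rw [upLaplacian, boundaryMap, coboundaryMap, ← Matrix.toLin'_mul, Matrix.charpoly_toLin']

end Multicomplex

/-! ### Assembly of the theorem -/

theorem countP_conjugateParts_sum {ι : Type*} (S : Finset ι) (v : ι → Fin n → ℕ)
    {l : List (Fin n)} (hl : l.Nodup) (h0 : ∀ p, ∀ i, i ∉ l → v p i = 0)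
    (hv : ∀ p, (l.map (v p)).SortedGE) (c : ℕ) :
    (∑ p ∈ S, conjugateParts (v p)).countP (c < ·) = (l.map fun j => ∑ p ∈ S, v p j).getD c 0 := by
  rw [← Multiset.coe_countPAddMonoidHom, map_sum]
  simp only [Multiset.coe_countPAddMonoidHom, countP_conjugateParts hl (h0 _) (hv _)]
  by_cases hc : c < l.length
  · simp [hc]
  · simp [hc]

theorem sortedGE_map_of_antitoneOn {l : List (Fin n)} (hl : l.Pairwise (· < ·)) {v : Fin n → ℕ}
    (hv : AntitoneOn v {i | i ∈ l}) : (l.map v).SortedGE :=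
  List.Pairwise.sortedGE (List.pairwise_map.2
    (hl.imp_of_mem fun ha hb hab => hv ha hb hab.le))

theorem mainTheorem1 {n : ℕ} (M : Multicomplex n) (hM : M.IsShifted) (k : ℕ) :
    (∀ μ : ℝ, Module.End.HasEigenvalue (M.upLaplacian k) μ → ∃ a : ℕ, μ = a) ∧
    ∃ s : Multiset ℕ,
      M.upSpectrum k = s.map (fun a : ℕ => (a : ℝ)) ∧
      diagramOfParts s = diagramOfParts
        (∑ p ∈ M.squareRoots.filter (fun p => 2 * p.degree ≤ k),
          conjugateParts ((M.piece p).degreeSequence (k + 1 - 2 * p.degree))) ∧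
      (diagramOfParts s).transpose = diagramOfVector (M.paritySum (k + 1)) ∧
      AntitoneOn (M.paritySum (k + 1)) M.vertices := by
  classical
  -- Only vertices are listed: shiftedness says nothing about other variables, whose exponents
  -- vanish throughout `M`.
  let l : List (Fin n) := (Finset.univ.filter (· ∈ M.vertices)).sort (· ≤ ·)
  have hmem : ∀ i, i ∈ l ↔ i ∈ M.vertices := fun i => by simp [l]
  have hl : l.Pairwise (· < ·) := (Finset.sortedLT_sort _).pairwise
  have hnd : l.Nodup := Finset.sort_nodup _ _
  have hV : (l.toFinset : Set (Fin n)) = M.vertices := by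
    ext i
    simp [hmem]
  have hset : {i | i ∈ l} = M.vertices := Set.ext hmem
  have hshift : IsShiftedFamily l.toFinset (Subtype.val : M.graded (k + 1) → Mon n) :=
    Multicomplex.graded_isShiftedFamily (fun m i hi j hij hm _ => hM m i j hm hij (hV ▸ hi)) _
  have hanti : AntitoneOn (M.paritySum (k + 1)) M.vertices :=
    hV ▸ Multicomplex.paritySum_antitoneOn hshift
  have hsorted : (l.map (M.paritySum (k + 1))).SortedGE :=
    sortedGE_map_of_antitoneOn hl (hset ▸ hanti)
  have hzero : ∀ i, i ∉ l → M.paritySum (k + 1) i = 0 := fun i hi =>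
    Multicomplex.paritySum_eq_zero _ fun h => hi ((hmem i).2 h)
  obtain ⟨s, hs0, hs, hsc⟩ := exists_spectrum l hl Subtype.val Subtype.val_injective hshift
  rw [show oddCount (Subtype.val : M.graded (k + 1) → Mon n) = M.paritySum (k + 1) from
    funext (M.oddCount_graded _)] at hsc
  obtain ⟨N, hN⟩ := Matrix.charpoly_roots_of_det_one_sub_smul (s := s.map fun a : ℕ => (a : ℝ))
    (G := M.boundaryMatrix k * (M.boundaryMatrix k).transpose) (by simpa using hs0) fun x => by
      rw [Matrix.det_one_sub_smul_mul_comm, M.transpose_boundaryMatrix_mul k hV.ge, hs,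
        Multiset.map_map]
      rfl
  have hspec : M.upSpectrum k =
      (s + Multiset.replicate N 0).map (fun a : ℕ => (a : ℝ)) := by
    rw [Multicomplex.upSpectrum, M.upLaplacian_charpoly, hN]
    simp
  have hcount : ∀ c, (s + Multiset.replicate N 0).countP (c < ·) =
      (l.map (M.paritySum (k + 1))).getD c 0 := fun c => by
    rw [Multiset.countP_add, hsc, Multiset.countP_eq_zero.2, add_zero]
    intro a ha
    rw [Multiset.eq_of_mem_replicate ha]
    exact Nat.not_lt_zero c
  refine ⟨fun μ hμ => ?_, _, hspec, ?_, ?_, hanti⟩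
  · have hroot : μ ∈ M.upSpectrum k :=
      (Polynomial.mem_roots (LinearMap.charpoly_monic _).ne_zero).2
        (Module.End.hasEigenvalue_iff_isRoot_charpoly _ _ |>.1 hμ)
    rw [hspec] at hroot
    obtain ⟨a, _, ha⟩ := Multiset.mem_map.1 hroot
    exact ⟨a, ha.symm⟩
  · rw [diagramOfParts_eq_iff]
    intro c
    rw [hcount]
    simp only [Multicomplex.degreeSequence_piece]
    rw [countP_conjugateParts_sum _ (fun p => (M.piece p).paritySum (k + 1 - 2 * p.degree)) hnd]
    · simp only [← M.paritySum_eq_sum_piece]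
    · exact fun p i hi => Multicomplex.paritySum_eq_zero _ fun h =>
        hi ((hmem i).2 (M.vertices_piece_subset p h))
    · exact fun p => sortedGE_map_of_antitoneOn hl (hset ▸ hV ▸
        Multicomplex.paritySum_antitoneOn (hM.piece_graded hV.le p _))
  · exact transpose_diagramOfParts_eq hnd hzero hsorted hcount
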